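/- Let $K$ be a field with a discrete valuation $v$ whose value group is $\mathbb{Z}$, and assume that $(K,v)$ is henselian. Let $|\cdot|$ be an absolute value on $K$ associated to $v$, so that $|x| = c^{-v(x)}$ for $x \neq 0$, with a fixed real $c>1$. It extends uniquely to an algebraic closure of $K$; let $\mathbb{C}_v$ be the completion of that algebraic closure. Equip $\mathbb{P}^1(\mathbb{C}_v)$ with the chordal metric $$\rho([x_1,y_1],[x_2,y_2]) = \frac{|x_1y_2-x_2y_1|}{\max(|x_1|,|y_1|)\,\max(|x_2|,|y_2|)}.$$ For a non-constant polynomial $\phi \in K[z]$, let $J_\phi \subseteq \mathbb{P}^1(\mathbb{C}_v)$ be its Julia set, i.e. the set of points having no neighbourhood on which the family of iterates $\{\phi^n\}_{n\ge 0}$ is equicontinuous with respect to $\rho$, and let $J_\phi(K) = J_\phi \cap \mathbb{P}^1(K)$ be its $K$-rational Julia set. A fixed point $z \in \mathbb{C}_v$ of $\phi$ is called repelling if $|\phi'(z)|>1$. **Theorem.** Let $\phi \in K[z]$ be a polynomial of degree $3$. If $J_\phi(K)$ is non-empty, then $J_\phi(K)$ contains a repelling fixed point of $\phi$. -/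

import Mathlib

open scoped WithZero

noncomputable section

namespace CubicJulia

/-- The norm of `K` is an absolute value associated to the (multiplicatively written) discrete
valuation `v`: if `v x = exp n`, that is, if the additive valuation of `x` is `-n`, then
`‖x‖ = c ^ n`, where `c > 1` is a fixed real number. In particular uniformizers have norm
`c⁻¹ < 1`. -/
def IsAssociatedNorm {K : Type*} [NormedField K] (v : Valuation K ℤᵐ⁰) : Prop :=
  ∃ c : ℝ, 1 < c ∧ ∀ x : K, x ≠ 0 → ‖x‖ = c ^ WithZero.log (v x)

section ProjectiveLine

/-! The projective line over a field `C` is `OnePoint C`, i.e. `C` together with the point `∞`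
(as a set; the topology used below is the one of the chordal metric, not the topology of
the one-point compactification). -/

variable {C : Type*} [NormedField C]

/-- Homogeneous coordinates of a point of `ℙ¹(C)`: `[z, 1]` for `z ∈ C`, and `[1, 0]` for `∞`. -/
def homCoords (P : OnePoint C) : C × C :=
  P.elim (1, 0) (fun z => (z, 1))

/-- The non-Archimedean chordal metric on `ℙ¹(C)`: the distance between `[x₁, y₁]` and `[x₂, y₂]`
is `|x₁ y₂ - x₂ y₁| / (max (|x₁|, |y₁|) * max (|x₂|, |y₂|))`. -/
def chordalDist (P Q : OnePoint C) : ℝ :=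
  ‖(homCoords P).1 * (homCoords Q).2 - (homCoords Q).1 * (homCoords P).2‖ /
    (max ‖(homCoords P).1‖ ‖(homCoords P).2‖ * max ‖(homCoords Q).1‖ ‖(homCoords Q).2‖)

/-- The action of a non-constant polynomial on `ℙ¹(C)`: it fixes `∞`. -/
def polyMap (f : Polynomial C) : OnePoint C → OnePoint C :=
  OnePoint.map (fun z => f.eval z)

/-- Equicontinuity at `P` of the family of all iterates of `f`, for the chordal metric. -/
def IteratesEquicontinuousAt (f : Polynomial C) (P : OnePoint C) : Prop :=
  ∀ ε : ℝ, 0 < ε → ∃ δ : ℝ, 0 < δ ∧ ∀ Q : OnePoint C, chordalDist P Q < δ →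
    ∀ n : ℕ, chordalDist ((polyMap f)^[n] P) ((polyMap f)^[n] Q) < ε

/-- The Julia set of `f`: the points of `ℙ¹(C)` which have no neighbourhood on which the family of
iterates of `f` is equicontinuous. -/
def juliaSet (f : Polynomial C) : Set (OnePoint C) :=
  {P | ¬ ∃ r : ℝ, 0 < r ∧ ∀ Q : OnePoint C, chordalDist P Q < r → IteratesEquicontinuousAt f Q}

/-- `z` is a repelling fixed point of `f`: `f z = z` and `|f' z| > 1`. -/
def IsRepellingFixedPoint (f : Polynomial C) (z : C) : Prop :=
  f.eval z = z ∧ 1 < ‖f.derivative.eval z‖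

end ProjectiveLine

/-- The `K`-rational Julia set `J_φ ∩ ℙ¹(K)` of a polynomial `φ` over `K`, where `J_φ` is the
Julia set in `ℙ¹(C)`. -/
def rationalJuliaSet {K : Type*} [Field K] (C : Type*) [NormedField C] [Algebra K C]
    (φ : Polynomial K) : Set (OnePoint C) :=
  juliaSet (φ.map (algebraMap K C)) ∩ Set.range (OnePoint.map (algebraMap K C))

end CubicJulia

end

/-! Over the algebraic closure, `φ(z) = z + a(z - α)(z - β)(z - γ)` with fixed points `α, β, γ`, and
the multiplier at `γ` is `1 + a(γ - α)(γ - β)`. The critical scale is `r = |a|^(-1/2)`. If the fixed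
points lie in one disk of radius `r`, then `φ` has good reduction there: it does not expand the
chordal metric of that disk, and the Julia set is empty (`juliaSet_eq_empty`). Otherwise the largest
distance `R` between fixed points satisfies `|a|R² > 1`, and any fixed point at distance `R` from
both others is repelling, hence in the Julia set.

It remains to find such a fixed point in `K`. By a Krasner-type argument from Hensel's lemma
(`IsAssociatedNorm.exists_algebraMap_eq`), it suffices that some point of `K` lies at distance less
than `R` from it. In an isosceles configuration a rational function of the coefficients gives this
point (`exists_norm_algebraMap_sub_lt`). In an equilateral one, the given rational Julia point
serves: it and its image stay in the disk of radius `R`, which forces it close to a fixed point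
(`norm_sub_lt_of_mem_juliaSet`). -/

namespace CubicJulia

/-! ### Chordal metrics attached to disks -/

section Metric

variable {C : Type*} [NormedField C]

/-- The norm of the `2 × 2` determinant of the homogeneous coordinates of two points. -/
noncomputable def detNorm (P Q : OnePoint C) : ℝ :=
  ‖(homCoords P).1 * (homCoords Q).2 - (homCoords Q).1 * (homCoords P).2‖

/-- The size `max R ‖z - α‖` of a finite point with respect to the disk `D(α, R)`. -/
noncomputable def height (α : C) (R : ℝ) (P : OnePoint C) : ℝ :=
  P.elim 1 (fun z => max R ‖z - α‖)

/-- The chordal metric with respect to the disk `D(α, R)`. -/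
noncomputable def diskDist (α : C) (R : ℝ) (P Q : OnePoint C) : ℝ :=
  detNorm P Q / (height α R P * height α R Q)

@[simp] lemma homCoords_coe (z : C) : homCoords (z : OnePoint C) = (z, 1) := rfl
@[simp] lemma homCoords_infty : homCoords (OnePoint.infty : OnePoint C) = (1, 0) := rfl
@[simp] lemma height_coe (α : C) (R : ℝ) (z : C) : height α R z = max R ‖z - α‖ := rfl
@[simp] lemma height_infty (α : C) (R : ℝ) :
    height α R (OnePoint.infty : OnePoint C) = 1 := rfl
@[simp] lemma polyMap_coe (f : Polynomial C) (z : C) : polyMap f z = (f.eval z : C) := rfl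
@[simp] lemma polyMap_infty (f : Polynomial C) :
    polyMap f OnePoint.infty = OnePoint.infty := rfl

@[simp] lemma detNorm_coe (z w : C) : detNorm (z : OnePoint C) w = ‖z - w‖ := by
  simp [detNorm]

@[simp] lemma detNorm_infty_coe (w : C) : detNorm OnePoint.infty (w : OnePoint C) = 1 := by
  simp [detNorm]

@[simp] lemma detNorm_coe_infty (w : C) : detNorm (w : OnePoint C) OnePoint.infty = 1 := by
  simp [detNorm]

@[simp] lemma detNorm_self (P : OnePoint C) : detNorm P P = 0 := by
  simp [detNorm]

lemma detNorm_nonneg (P Q : OnePoint C) : 0 ≤ detNorm P Q := norm_nonneg _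

lemma height_pos (α : C) {R : ℝ} (hR : 0 < R) (P : OnePoint C) : 0 < height α R P := by
  induction P using OnePoint.rec with
  | infty => simp
  | coe z => exact lt_max_of_lt_left hR

lemma chordalDist_eq_diskDist (P Q : OnePoint C) : chordalDist P Q = diskDist 0 1 P Q := by
  have h (P : OnePoint C) : max ‖(homCoords P).1‖ ‖(homCoords P).2‖ = height 0 1 P := by
    induction P using OnePoint.rec with
    | infty => simp
    | coe z => simp [max_comm]
  rw [chordalDist, h, h]; rfl

@[simp] lemma chordalDist_self (P : OnePoint C) : chordalDist P P = 0 := by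
  simp [chordalDist_eq_diskDist, diskDist]

lemma chordalDist_coe (z w : C) :
    chordalDist (z : OnePoint C) w = ‖z - w‖ / (max 1 ‖z‖ * max 1 ‖w‖) := by
  simp [chordalDist_eq_diskDist, diskDist]

lemma chordalDist_coe_le (z w : C) : chordalDist (z : OnePoint C) w ≤ ‖z - w‖ := by
  rw [chordalDist_coe]
  exact div_le_self (norm_nonneg _)
    (one_le_mul_of_one_le_of_one_le (le_max_left _ _) (le_max_left _ _))

lemma height_le_mul_height (α β : C) {R S : ℝ} (hR : 0 < R) (hS : 0 < S) :
    ∃ κ : ℝ, 0 < κ ∧ ∀ P : OnePoint C, height α R P ≤ κ * height β S P := by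
  refine ⟨1 + (R + ‖β - α‖) / S, by positivity, fun P => ?_⟩
  induction P using OnePoint.rec with
  | infty => simp; positivity
  | coe z =>
    rw [height_coe, height_coe, add_mul, one_mul]
    have h1 : (R + ‖β - α‖) ≤ (R + ‖β - α‖) / S * max S ‖z - β‖ := by
      rw [div_mul_eq_mul_div, le_div_iff₀ hS]
      exact mul_le_mul_of_nonneg_left (le_max_left _ _) (by positivity)
    have h2 : ‖z - α‖ ≤ ‖z - β‖ + ‖β - α‖ := norm_sub_le_norm_sub_add_norm_sub z β α
    have h3 := le_max_right S ‖z - β‖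
    have := norm_nonneg (z - β)
    have := norm_nonneg (β - α)
    exact max_le (by linarith) (by linarith)

/-- All disk metrics are Lipschitz equivalent, so equicontinuity may be tested in the one adapted to
the fixed points. -/
lemma diskDist_le_mul_diskDist (α β : C) {R S : ℝ} (hR : 0 < R) (hS : 0 < S) :
    ∃ κ : ℝ, 0 < κ ∧ ∀ P Q : OnePoint C, diskDist α R P Q ≤ κ * diskDist β S P Q := by
  obtain ⟨κ, hκ, h⟩ := height_le_mul_height β α hS hR
  refine ⟨κ * κ, by positivity, fun P Q => ?_⟩
  have hP := height_pos α hR P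
  have hQ := height_pos α hR Q
  have hP' := height_pos β hS P
  have hQ' := height_pos β hS Q
  rw [diskDist, diskDist, ← mul_div_assoc, div_le_div_iff₀ (by positivity) (by positivity)]
  calc detNorm P Q * (height β S P * height β S Q)
      ≤ detNorm P Q * ((κ * height α R P) * (κ * height α R Q)) := by
        have := detNorm_nonneg P Q
        gcongr <;> apply h
    _ = _ := by ring

end Metric

/-! ### Criteria for equicontinuity -/

section Fatou

variable {C : Type*} [NormedField C]

/-- If `f` does not increase the metric of a disk on a forward invariant open set, then its iterates
are equicontinuous at the points of that set. -/
lemma iteratesEquicontinuousAt_of_nonexpanding (f : Polynomial C) (α : C) {R : ℝ} (hR : 0 < R)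
    (S : Set (OnePoint C)) (hmaps : Set.MapsTo (polyMap f) S S)
    (hopen : ∀ P ∈ S, ∃ δ : ℝ, 0 < δ ∧ ∀ Q, chordalDist P Q < δ → Q ∈ S)
    (hne : ∀ P ∈ S, ∀ Q ∈ S, diskDist α R (polyMap f P) (polyMap f Q) ≤ diskDist α R P Q)
    {P : OnePoint C} (hP : P ∈ S) : IteratesEquicontinuousAt f P := by
  obtain ⟨κ, hκ, h1⟩ := diskDist_le_mul_diskDist (0 : C) α one_pos hR
  obtain ⟨μ, hμ, h2⟩ := diskDist_le_mul_diskDist α (0 : C) hR one_pos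
  intro ε hε
  obtain ⟨δ, hδ, hS⟩ := hopen P hP
  refine ⟨min δ (ε / (κ * μ)), by positivity, fun Q hQ n => ?_⟩
  have hQS := hS Q (hQ.trans_le (min_le_left _ _))
  have hit : ∀ n, diskDist α R ((polyMap f)^[n] P) ((polyMap f)^[n] Q) ≤ diskDist α R P Q := by
    intro n
    induction n with
    | zero => simp
    | succ n ih =>
      rw [Function.iterate_succ_apply', Function.iterate_succ_apply']
      exact (hne _ (hmaps.iterate n hP) _ (hmaps.iterate n hQS)).trans ih
  have hQ' := (lt_div_iff₀ (mul_pos hκ hμ)).1 (hQ.trans_le (min_le_right _ _))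
  rw [chordalDist_eq_diskDist] at hQ' ⊢
  calc _ ≤ κ * diskDist α R ((polyMap f)^[n] P) ((polyMap f)^[n] Q) := h1 _ _
    _ ≤ κ * diskDist α R P Q := by gcongr; exact hit n
    _ ≤ κ * (μ * diskDist 0 1 P Q) := by gcongr; exact h2 _ _
    _ < ε := by linarith

lemma notMem_juliaSet_of_open (f : Polynomial C) (S : Set (OnePoint C))
    (hopen : ∀ P ∈ S, ∃ δ : ℝ, 0 < δ ∧ ∀ Q, chordalDist P Q < δ → Q ∈ S)
    (heq : ∀ P ∈ S, IteratesEquicontinuousAt f P) {P : OnePoint C} (hP : P ∈ S) :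
    P ∉ juliaSet f := by
  obtain ⟨δ, hδ, h⟩ := hopen P hP
  exact fun hJ => hJ ⟨δ, hδ, fun Q hQ => heq Q (h Q hQ)⟩

/-- Around a finite point, the chordal metric induces the topology of `C`. -/
lemma exists_forall_chordalDist_lt (z : C) {η : ℝ} (hη : 0 < η) :
    ∃ δ : ℝ, 0 < δ ∧ ∀ Q : OnePoint C, chordalDist z Q < δ → ∃ w : C, Q = w ∧ ‖z - w‖ < η := by
  set M := max 1 ‖z‖ with hM
  have hM1 : 1 ≤ M := le_max_left _ _
  have hzM : ‖z‖ ≤ M := le_max_right _ _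
  -- The first bound excludes `∞` and forces `max 1 ‖w‖ ≤ 2 * M`; the second then gives `‖z - w‖ <
  -- η`.
  refine ⟨min (1 / (2 * M)) (η / (4 * M * M)), by positivity, fun Q hQ => ?_⟩
  have hQ1 := hQ.trans_le (min_le_left _ _)
  have hQ2 := hQ.trans_le (min_le_right _ _)
  induction Q using OnePoint.rec with
  | infty =>
    rw [chordalDist_eq_diskDist] at hQ1
    simp only [diskDist, detNorm_coe_infty, height_coe, height_infty, sub_zero, mul_one,
      ← hM] at hQ1
    rw [div_lt_div_iff₀ (by positivity) (by positivity)] at hQ1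
    linarith
  | coe w =>
    refine ⟨w, rfl, ?_⟩
    rw [chordalDist_coe, ← hM] at hQ1 hQ2
    have hw : ‖w‖ ≤ ‖z‖ + ‖z - w‖ := by
      have := norm_sub_le z (z - w)
      simpa using this
    rw [div_lt_div_iff₀ (by positivity) (by positivity)] at hQ1 hQ2
    have hN : max 1 ‖w‖ ≤ 2 * M := by
      by_contra! hlt
      have h1 : max 1 ‖w‖ = ‖w‖ := by
        rcases max_choice 1 ‖w‖ with h | h
        · rw [h] at hlt; linarith
        · exact h
      rw [h1] at hQ1 hlt
      have : ‖z - w‖ * 2 < ‖w‖ := by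
        have h3 : M * (‖z - w‖ * 2) < M * ‖w‖ := by linarith
        exact lt_of_mul_lt_mul_left h3 (by positivity)
      linarith
    have h4 : ‖z - w‖ * (4 * M * M) < η * (2 * M * M) * 1 := by
      calc _ < η * (M * max 1 ‖w‖) := hQ2
        _ ≤ η * (M * (2 * M)) := by gcongr
        _ = _ := by ring
    have h5 : 0 < M * M := by positivity
    nlinarith

/-- The iterates of `f` are equicontinuous at `z` if they are so at `f z`. -/
lemma IteratesEquicontinuousAt.of_polyMap (f : Polynomial C) {z : C}
    (h : IteratesEquicontinuousAt f (polyMap f z)) :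
    IteratesEquicontinuousAt f (z : OnePoint C) := by
  intro ε hε
  obtain ⟨δ, hδ, h⟩ := h ε hε
  obtain ⟨η, hη, hc⟩ := Metric.continuous_iff.1 f.continuous z δ hδ
  obtain ⟨θ, hθ, ht⟩ := exists_forall_chordalDist_lt z hη
  refine ⟨min ε θ, by positivity, fun Q hQ n => ?_⟩
  cases n with
  | zero => exact hQ.trans_le (min_le_left _ _)
  | succ n =>
    rw [Function.iterate_succ_apply, Function.iterate_succ_apply]
    obtain ⟨w, rfl, hw⟩ := ht Q (hQ.trans_le (min_le_right _ _))
    refine h _ ?_ n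
    rw [polyMap_coe, polyMap_coe]
    refine (chordalDist_coe_le _ _).trans_lt ?_
    rw [← dist_eq_norm, dist_comm]
    exact hc w (by rwa [dist_comm, dist_eq_norm])

end Fatou

/-! ### Repelling fixed points -/

section Repelling

variable {C : Type*} [NormedField C]

/-- Repelling fixed points belong to the Julia set. -/
lemma IsRepellingFixedPoint.mem_juliaSet {f : Polynomial C} {z : C}
    (h : IsRepellingFixedPoint f z) : (z : OnePoint C) ∈ juliaSet f := by
  obtain ⟨hz, hd⟩ := h
  rintro ⟨r, hr, hE⟩
  have hE := hE z (by simpa using hr)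
  obtain ⟨μ, hμ1, hμ⟩ := exists_between hd
  -- The multiplier itself witnesses that the norm is nontrivial, as differential calculus requires.
  let : NontriviallyNormedField C := { ‹NormedField C› with non_trivial := ⟨_, hd⟩ }
  have hderiv := f.hasDerivAt z
  have hexp : ∃ η > 0, ∀ w : C, ‖z - w‖ < η → μ * ‖z - w‖ ≤ ‖z - f.eval w‖ := by
    have := hderiv.isLittleO.def (sub_pos.2 hμ)
    obtain ⟨η, hη, hb⟩ := Metric.eventually_nhds_iff.1 this
    refine ⟨η, hη, fun w hw => ?_⟩
    have hb := hb (y := w) (by rwa [dist_comm, dist_eq_norm])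
    rw [hz, smul_eq_mul] at hb
    have h1 : ‖(w - z) * f.derivative.eval z‖ ≤
        ‖f.eval w - z‖ + ‖f.eval w - z - (w - z) * f.derivative.eval z‖ := by
      have := norm_sub_le (f.eval w - z) (f.eval w - z - (w - z) * f.derivative.eval z)
      simpa using this
    rw [norm_mul] at h1
    rw [norm_sub_rev z w, norm_sub_rev z]
    nlinarith
  obtain ⟨η, hη, hexp⟩ := hexp
  obtain ⟨ε, hε, hnear⟩ := exists_forall_chordalDist_lt z hη
  obtain ⟨δ, hδ, hE⟩ := hE ε hε
  obtain ⟨n, hn⟩ := exists_pow_lt_of_lt_one hδ (inv_lt_one_of_one_lt₀ hd)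
  -- Powers of the inverse multiplier supply nonzero perturbations of arbitrarily small norm.
  -- Equicontinuity keeps the orbit of `z + t` near `z`, where each step expands distances by at
  -- least `μ > 1`.
  set t := ((f.derivative.eval z)⁻¹) ^ n with ht
  have ht0 : t ≠ 0 := pow_ne_zero _ (inv_ne_zero (norm_pos_iff.1 (by linarith)))
  have htn : ‖t‖ < δ := by rwa [ht, norm_pow, norm_inv]
  have hfix : ∀ k, (polyMap f)^[k] (z : OnePoint C) = z := fun k =>
    Function.iterate_fixed (by rw [polyMap_coe, hz]) k
  have horb : ∀ k, (polyMap f)^[k] ((z + t : C) : OnePoint C) =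
      (((fun w => f.eval w)^[k] (z + t) : C) : OnePoint C) := by
    intro k
    induction k with
    | zero => rfl
    | succ k ih => rw [Function.iterate_succ_apply', Function.iterate_succ_apply', ih, polyMap_coe]
  have hclose : ∀ k, ‖z - (fun w => f.eval w)^[k] (z + t)‖ < η := by
    intro k
    have h1 := hE (z + t : C) ((chordalDist_coe_le _ _).trans_lt (by simpa using htn)) k
    rw [hfix, horb] at h1
    obtain ⟨w, hw, hwη⟩ := hnear _ h1
    rwa [OnePoint.coe_injective hw]
  have hgrow : ∀ k, μ ^ k * ‖t‖ ≤ ‖z - (fun w => f.eval w)^[k] (z + t)‖ := by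
    intro k
    induction k with
    | zero => simp
    | succ k ih =>
      rw [Function.iterate_succ_apply']
      refine le_trans ?_ (hexp _ (hclose k))
      rw [pow_succ', mul_assoc]
      gcongr
  obtain ⟨k, hk⟩ := pow_unbounded_of_one_lt (η / ‖t‖) hμ1
  rw [div_lt_iff₀ (norm_pos_iff.2 ht0)] at hk
  linarith [hclose k, hgrow k]

end Repelling

/-! ### Ultrametric inequalities -/

section Ultrametric

variable {E : Type*} [NormedField E] [IsUltrametricDist E]

lemma norm_add_eq_of_lt {x y : E} (h : ‖y‖ < ‖x‖) : ‖x + y‖ = ‖x‖ := by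
  rw [IsUltrametricDist.norm_add_eq_max_of_norm_ne_norm h.ne', max_eq_left h.le]

lemma norm_sub_eq_of_lt {x y : E} (h : ‖y‖ < ‖x‖) : ‖x - y‖ = ‖x‖ := by
  rw [sub_eq_add_neg]; exact norm_add_eq_of_lt (by rwa [norm_neg])

lemma norm_add_le_of_le {x y : E} {r : ℝ} (hx : ‖x‖ ≤ r) (hy : ‖y‖ ≤ r) : ‖x + y‖ ≤ r :=
  (IsUltrametricDist.norm_add_le_max x y).trans (max_le hx hy)

lemma norm_sub_le_of_le {x y : E} {r : ℝ} (hx : ‖x‖ ≤ r) (hy : ‖y‖ ≤ r) : ‖x - y‖ ≤ r := by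
  rw [sub_eq_add_neg]; exact norm_add_le_of_le hx (by rwa [norm_neg])

end Ultrametric

/-! ### Dynamics of a cubic in terms of its fixed points -/

section Cubic

open Polynomial

variable {C : Type*} [NormedField C]

/-- The cubic polynomial with leading coefficient `a` and fixed points `α`, `β`, `γ`. -/
noncomputable def fixedPointCubic (a α β γ : C) : C[X] :=
  X + Polynomial.C a * ((X - Polynomial.C α) * (X - Polynomial.C β) * (X - Polynomial.C γ))

lemma eval_fixedPointCubic (a α β γ z : C) :
    (fixedPointCubic a α β γ).eval z = z + a * ((z - α) * (z - β) * (z - γ)) := by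
  simp [fixedPointCubic]

lemma fixedPointCubic_perm_left (a α β γ : C) :
    fixedPointCubic a α β γ = fixedPointCubic a β α γ := by
  simp only [fixedPointCubic]; ring

lemma fixedPointCubic_rotate (a α β γ : C) :
    fixedPointCubic a α β γ = fixedPointCubic a β γ α := by
  simp only [fixedPointCubic]; ring

/-- The points of the projective line outside of the disk `D(α, R)`. -/
def diskCompl (α : C) (R : ℝ) : Set (OnePoint C) :=
  {P | ∀ z : C, P = z → R < ‖z - α‖}

lemma coe_mem_diskCompl {α : C} {R : ℝ} {z : C} : (z : OnePoint C) ∈ diskCompl α R ↔ R < ‖z - α‖ := by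
  simp [diskCompl]

lemma infty_mem_diskCompl {α : C} {R : ℝ} : OnePoint.infty ∈ diskCompl α R := by
  simp [diskCompl]

variable [IsUltrametricDist C] {a α β γ : C} {R : ℝ}

/-- The multiplier is `1 + a(γ - α)(γ - β)`, whose second term dominates. -/
lemma isRepellingFixedPoint_fixedPointCubic (hα : ‖γ - α‖ = R) (hβ : ‖γ - β‖ = R)
    (ha : 1 < ‖a‖ * R ^ 2) : IsRepellingFixedPoint (fixedPointCubic a α β γ) γ := by
  refine ⟨by simp [eval_fixedPointCubic], ?_⟩
  have h : (fixedPointCubic a α β γ).derivative.eval γ = a * ((γ - α) * (γ - β)) + 1 := by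
    simp [fixedPointCubic, derivative_mul]; ring
  have h2 : ‖a * ((γ - α) * (γ - β))‖ = ‖a‖ * R ^ 2 := by
    rw [norm_mul, norm_mul, hα, hβ, sq]
  rw [h, norm_add_eq_of_lt (by rwa [norm_one, h2]), h2]
  exact ha

lemma norm_sub_le_height (hR : ‖β - α‖ ≤ R) (z : C) : ‖z - β‖ ≤ height α R (z : OnePoint C) := by
  rw [height_coe]
  have : z - β = (z - α) - (β - α) := by ring
  rw [this]
  exact norm_sub_le_of_le (le_max_right _ _) (hR.trans (le_max_left _ _))

/-- The difference quotient is `1` plus `a` times a sum of three products of two differences, each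
of norm at most `M²`; the `1` is absorbed because `1 ≤ ‖a‖ * R ^ 2`. -/
lemma norm_eval_sub_eval_le (hR : 0 < R) (hβ : ‖β - α‖ ≤ R) (hγ : ‖γ - α‖ ≤ R)
    (ha : 1 ≤ ‖a‖ * R ^ 2) (z w : C) :
    ‖(fixedPointCubic a α β γ).eval z - (fixedPointCubic a α β γ).eval w‖ ≤
      ‖z - w‖ * (‖a‖ * max (height α R (z : OnePoint C)) (height α R (w : OnePoint C)) ^ 2) := by
  set M := max (height α R (z : OnePoint C)) (height α R (w : OnePoint C))
  have hRM : R ≤ M := (le_max_left _ _).trans (le_max_left _ _)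
  have hM0 : 0 ≤ M := hR.le.trans hRM
  have hz {x : C} (hx : ‖x - α‖ ≤ R) : ‖z - x‖ ≤ M :=
    (norm_sub_le_height hx z).trans (le_max_left _ _)
  have hw {x : C} (hx : ‖x - α‖ ≤ R) : ‖w - x‖ ≤ M :=
    (norm_sub_le_height hx w).trans (le_max_right _ _)
  have hα : ‖α - α‖ ≤ R := by simpa using hR.le
  have key : (fixedPointCubic a α β γ).eval z - (fixedPointCubic a α β γ).eval w =
      (z - w) * (1 + a * ((z - β) * (z - γ) + (w - α) * (z - γ) + (w - α) * (w - β))) := by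
    simp only [eval_fixedPointCubic]; ring
  rw [key, norm_mul]
  refine mul_le_mul_of_nonneg_left (norm_add_le_of_le ?_ ?_) (norm_nonneg _)
  · rw [norm_one]; exact ha.trans (by gcongr)
  · rw [norm_mul, sq]
    refine mul_le_mul_of_nonneg_left (norm_add_le_of_le (norm_add_le_of_le ?_ ?_) ?_)
      (norm_nonneg _) <;> rw [norm_mul]
    exacts [mul_le_mul (hz hβ) (hz hγ) (norm_nonneg _) hM0,
      mul_le_mul (hw hα) (hz hγ) (norm_nonneg _) hM0,
      mul_le_mul (hw hα) (hw hβ) (norm_nonneg _) hM0]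

/-- With `m`, `l` the heights of two finite points, the numerator grows by a factor at most `‖a‖ *
max m l ^ 2` and, by `hS`, the denominator by at least `‖a‖ ^ 2 * m ^ 2 * l ^ 2`. The latter is no
smaller, since `‖a‖ * m ^ 2` and `‖a‖ * l ^ 2` are at least `1`. -/
lemma diskDist_polyMap_le (hR : 0 < R) (hβ : ‖β - α‖ ≤ R) (hγ : ‖γ - α‖ ≤ R)
    (ha : 1 ≤ ‖a‖ * R ^ 2) (S : Set (OnePoint C))
    (hS : ∀ z : C, (z : OnePoint C) ∈ S → ‖a‖ * height α R (z : OnePoint C) ^ 3 ≤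
      height α R (polyMap (fixedPointCubic a α β γ) z))
    (P : OnePoint C) (hP : P ∈ S) (Q : OnePoint C) (hQ : Q ∈ S) :
    diskDist α R (polyMap (fixedPointCubic a α β γ) P) (polyMap (fixedPointCubic a α β γ) Q) ≤
      diskDist α R P Q := by
  have hRh (z : C) : R ≤ height α R (z : OnePoint C) := le_max_left _ _
  have hscale (z : C) : 1 ≤ ‖a‖ * height α R (z : OnePoint C) ^ 2 :=
    ha.trans (by gcongr; exact hRh z)
  have hgrow (z : C) (hz : (z : OnePoint C) ∈ S) : height α R (z : OnePoint C) ≤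
      height α R (polyMap (fixedPointCubic a α β γ) z) := by
    refine le_trans ?_ (hS z hz)
    have h1 := hscale z
    have h2 := height_pos α hR (z : OnePoint C)
    nlinarith
  have hpos := height_pos α hR
  induction P using OnePoint.rec with
  | infty =>
    induction Q using OnePoint.rec with
    | infty => simp
    | coe w =>
      have := hgrow w hQ
      have := hpos w
      simp only [diskDist, polyMap_infty, height_infty, one_mul, polyMap_coe, detNorm_infty_coe]
        at this ⊢
      gcongr
      assumption
  | coe z =>
    induction Q using OnePoint.rec with
    | infty =>
      have := hgrow z hP
      have := hpos z
      simp only [diskDist, polyMap_infty, height_infty, mul_one, polyMap_coe, detNorm_coe_infty]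
        at this ⊢
      gcongr
      assumption
    | coe w =>
      have h1 := norm_eval_sub_eval_le hR hβ hγ ha z w
      have hz := hS z hP
      have hw := hS w hQ
      have hz0 := hpos z
      have hw0 := hpos w
      have hsz := hscale z
      have hsw := hscale w
      have hz1 := hpos (polyMap (fixedPointCubic a α β γ) z)
      have hw1 := hpos (polyMap (fixedPointCubic a α β γ) w)
      rw [diskDist, diskDist, div_le_div_iff₀ (by positivity) (by positivity)]
      rw [polyMap_coe, polyMap_coe, detNorm_coe, detNorm_coe] at *
      set m := height α R (z : OnePoint C)
      set l := height α R (w : OnePoint C)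
      have hmax : max m l ^ 2 ≤ ‖a‖ * (m ^ 2 * l ^ 2) := by
        rcases max_choice m l with h | h <;> rw [h]
        · nlinarith [sq_nonneg m]
        · nlinarith [sq_nonneg l]
      calc _ ≤ ‖z - w‖ * (‖a‖ * max m l ^ 2) * (m * l) := by gcongr
        _ ≤ ‖z - w‖ * (‖a‖ * (‖a‖ * (m ^ 2 * l ^ 2))) * (m * l) := by gcongr
        _ = ‖z - w‖ * ((‖a‖ * m ^ 3) * (‖a‖ * l ^ 3)) := by ring
        _ ≤ _ := by gcongr

/-- Outside the disk all three factors have norm `‖z - α‖`, and the cubic term dominates `z - α`. -/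
lemma norm_eval_sub_eq (hβ : ‖β - α‖ ≤ R) (hγ : ‖γ - α‖ ≤ R) (ha : 1 ≤ ‖a‖ * R ^ 2)
    (hR : 0 < R) {z : C} (hz : R < ‖z - α‖) :
    ‖(fixedPointCubic a α β γ).eval z - α‖ = ‖a‖ * ‖z - α‖ ^ 3 := by
  have hx {x : C} (hx : ‖x - α‖ ≤ R) : ‖z - x‖ = ‖z - α‖ := by
    have : z - x = (z - α) - (x - α) := by ring
    rw [this, norm_sub_eq_of_lt (hx.trans_lt hz)]
  have h1 : ‖a * ((z - α) * (z - β) * (z - γ))‖ = ‖a‖ * ‖z - α‖ ^ 3 := by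
    rw [norm_mul, norm_mul, norm_mul, hx hβ, hx hγ]; ring
  have h2 : ‖z - α‖ < ‖a‖ * ‖z - α‖ ^ 3 := by
    have ha0 : 0 < ‖a‖ := by
      by_contra! h
      nlinarith [sq_nonneg R]
    have h3 : ‖a‖ * R ^ 2 < ‖a‖ * ‖z - α‖ ^ 2 := by gcongr
    have h4 : 0 < ‖z - α‖ := hR.trans hz
    nlinarith
  have h3 : (fixedPointCubic a α β γ).eval z - α = a * ((z - α) * (z - β) * (z - γ)) + (z - α) := by
    rw [eval_fixedPointCubic]; ring
  rw [h3, norm_add_eq_of_lt (by rwa [h1]), h1]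

/-- A polynomial with good reduction has empty Julia set. -/
lemma juliaSet_eq_empty (hR : 0 < R) (hβ : ‖β - α‖ ≤ R) (hγ : ‖γ - α‖ ≤ R)
    (ha : ‖a‖ * R ^ 2 = 1) : juliaSet (fixedPointCubic a α β γ) = ∅ := by
  refine Set.eq_empty_iff_forall_notMem.2 fun P => notMem_juliaSet_of_open _ Set.univ
    (fun _ _ => ⟨1, one_pos, fun _ _ => trivial⟩) (fun P hP => ?_) (Set.mem_univ P)
  refine iteratesEquicontinuousAt_of_nonexpanding _ α hR Set.univ (Set.mapsTo_univ _ _)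
    (fun _ _ => ⟨1, one_pos, fun _ _ => trivial⟩) ?_ hP
  refine diskDist_polyMap_le hR hβ hγ ha.ge _ fun z _ => ?_
  rw [polyMap_coe, height_coe, height_coe]
  rcases le_or_gt ‖z - α‖ R with h | h
  · rw [max_eq_left h]
    refine le_trans (le_of_eq ?_) (le_max_left _ _)
    linear_combination R * ha
  · rw [max_eq_right h.le, norm_eval_sub_eq hβ hγ ha.ge hR h]
    exact le_max_right _ _

/-- A point outside the disk and a point inside it are at `diskDist` exactly `1 / R`. -/
lemma isOpen_diskCompl (hR : 0 < R) (P : OnePoint C) (hP : P ∈ diskCompl α R) :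
    ∃ δ : ℝ, 0 < δ ∧ ∀ Q, chordalDist P Q < δ → Q ∈ diskCompl α R := by
  obtain ⟨κ, hκ, h⟩ := diskDist_le_mul_diskDist α (0 : C) hR one_pos
  refine ⟨1 / (κ * R), by positivity, fun Q hQ => ?_⟩
  rw [chordalDist_eq_diskDist, lt_div_iff₀ (by positivity)] at hQ
  have hd : diskDist α R P Q * R < 1 :=
    (mul_le_mul_of_nonneg_right (h P Q) hR.le).trans_lt (by linarith)
  induction Q using OnePoint.rec with
  | infty => exact infty_mem_diskCompl
  | coe w =>
    rw [coe_mem_diskCompl]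
    by_contra! hw
    refine hd.ne ?_
    induction P using OnePoint.rec with
    | infty => simp [diskDist, max_eq_left hw, hR.ne']
    | coe z =>
      rw [coe_mem_diskCompl] at hP
      have hzw : ‖z - w‖ = ‖z - α‖ := by
        have : z - w = (z - α) - (w - α) := by ring
        rw [this, norm_sub_eq_of_lt (hw.trans_lt hP)]
      have : ‖z - α‖ ≠ 0 := (hR.trans hP).ne'
      rw [diskDist, detNorm_coe, height_coe, height_coe, max_eq_left hw, max_eq_right hP.le, hzw]
      field_simp

lemma mapsTo_diskCompl (hR : 0 < R) (hβ : ‖β - α‖ ≤ R) (hγ : ‖γ - α‖ ≤ R)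
    (ha : 1 ≤ ‖a‖ * R ^ 2) :
    Set.MapsTo (polyMap (fixedPointCubic a α β γ)) (diskCompl α R) (diskCompl α R) := by
  intro P hP
  induction P using OnePoint.rec with
  | infty => exact infty_mem_diskCompl
  | coe z =>
    rw [coe_mem_diskCompl] at hP
    rw [polyMap_coe, coe_mem_diskCompl, norm_eval_sub_eq hβ hγ ha hR hP]
    have h1 : ‖a‖ * R ^ 2 ≤ ‖a‖ * ‖z - α‖ ^ 2 := by gcongr
    have h2 : 0 < ‖z - α‖ := hR.trans hP
    nlinarith

lemma iteratesEquicontinuousAt_of_mem_diskCompl (hR : 0 < R) (hβ : ‖β - α‖ ≤ R)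
    (hγ : ‖γ - α‖ ≤ R) (ha : 1 ≤ ‖a‖ * R ^ 2) {P : OnePoint C} (hP : P ∈ diskCompl α R) :
    IteratesEquicontinuousAt (fixedPointCubic a α β γ) P := by
  refine iteratesEquicontinuousAt_of_nonexpanding _ α hR _ (mapsTo_diskCompl hR hβ hγ ha)
    (isOpen_diskCompl hR) ?_ hP
  refine diskDist_polyMap_le hR hβ hγ ha _ fun z hz => ?_
  rw [coe_mem_diskCompl] at hz
  rw [polyMap_coe, height_coe, height_coe, max_eq_right hz.le, norm_eval_sub_eq hβ hγ ha hR hz]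
  exact le_max_right _ _

/-- A point of the Julia set is finite, and it and its image lie in every disk that contains the
fixed points and is large enough. -/
lemma exists_of_mem_juliaSet (hR : 0 < R) (hβ : ‖β - α‖ ≤ R) (hγ : ‖γ - α‖ ≤ R)
    (ha : 1 ≤ ‖a‖ * R ^ 2) {P : OnePoint C} (hP : P ∈ juliaSet (fixedPointCubic a α β γ)) :
    ∃ z : C, P = z ∧ ‖z - α‖ ≤ R ∧ ‖(fixedPointCubic a α β γ).eval z - α‖ ≤ R := by
  set f := fixedPointCubic a α β γ with hf
  have hout : P ∉ diskCompl α R := fun h => notMem_juliaSet_of_open f _ (isOpen_diskCompl hR)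
    (fun _ => iteratesEquicontinuousAt_of_mem_diskCompl hR hβ hγ ha) h hP
  induction P using OnePoint.rec with
  | infty => exact absurd infty_mem_diskCompl hout
  | coe z =>
    refine ⟨z, rfl, by simpa [coe_mem_diskCompl] using hout, ?_⟩
    by_contra! h
    -- The points whose image leaves the disk form an open set, and equicontinuity pulls back along
    -- `f`.
    refine notMem_juliaSet_of_open f {Q | ∃ w : C, Q = w ∧ R < ‖f.eval w - α‖} ?_ ?_
      ⟨z, rfl, h⟩ hP
    · rintro _ ⟨w, rfl, hw⟩
      have hopen : IsOpen {x : C | R < ‖f.eval x - α‖} :=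
        isOpen_lt continuous_const (f.continuous.sub continuous_const).norm
      obtain ⟨η, hη, hb⟩ := Metric.isOpen_iff.1 hopen w hw
      obtain ⟨δ, hδ, hd⟩ := exists_forall_chordalDist_lt w hη
      refine ⟨δ, hδ, fun Q hQ => ?_⟩
      obtain ⟨x, rfl, hx⟩ := hd Q hQ
      exact ⟨x, rfl, hb (by rwa [Metric.mem_ball, dist_comm, dist_eq_norm])⟩
    · rintro _ ⟨w, rfl, hw⟩
      refine IteratesEquicontinuousAt.of_polyMap f ?_
      exact iteratesEquicontinuousAt_of_mem_diskCompl hR hβ hγ ha (coe_mem_diskCompl.2 hw)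

/-- If the fixed points are equidistant, each point of the Julia set is close to one of them. -/
lemma norm_sub_lt_of_mem_juliaSet (hR : 0 < R) (hβ : ‖β - α‖ = R) (hγ : ‖γ - α‖ = R)
    (ha : 1 < ‖a‖ * R ^ 2) {z : C}
    (hP : (z : OnePoint C) ∈ juliaSet (fixedPointCubic a α β γ)) :
    ‖z - α‖ < R ∨ ‖z - β‖ < R ∨ ‖z - γ‖ < R := by
  obtain ⟨w, hw, h1, h2⟩ := exists_of_mem_juliaSet hR hβ.le hγ.le ha.le hP
  obtain rfl := OnePoint.coe_injective hw
  by_contra! h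
  obtain ⟨hα, hβ', hγ'⟩ := h
  -- This is `f z - z`, of norm at most `R`; three factors of norm at least `R` would make it at
  -- least `‖a‖ * R ^ 3 > R`.
  have h3 : a * ((z - α) * (z - β) * (z - γ)) =
      ((fixedPointCubic a α β γ).eval z - α) - (z - α) := by
    rw [eval_fixedPointCubic]; ring
  have h4 : ‖a * ((z - α) * (z - β) * (z - γ))‖ ≤ R := h3 ▸ norm_sub_le_of_le h2 h1
  rw [norm_mul, norm_mul, norm_mul] at h4
  have h5 : ‖a‖ * (R * R * R) ≤ ‖a‖ * (‖z - α‖ * ‖z - β‖ * ‖z - γ‖) := by gcongr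
  nlinarith

end Cubic

/-! ### Rationality of fixed points via Hensel's lemma -/

section Henselian

open Polynomial

variable {K : Type*} [NormedField K] {v : Valuation K (WithZero (Multiplicative ℤ))}

lemma IsAssociatedNorm.norm_le_one_iff (h : IsAssociatedNorm v) (x : K) : ‖x‖ ≤ 1 ↔ v x ≤ 1 := by
  obtain ⟨c, hc, h⟩ := h
  rcases eq_or_ne x 0 with rfl | hx
  · simp
  · have hv : v x ≠ 0 := (Valuation.ne_zero_iff v).2 hx
    rw [h x hx, zpow_le_one_iff_right₀ hc, ← WithZero.log_one, WithZero.log_le_log hv one_ne_zero]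

lemma IsAssociatedNorm.norm_lt_one_iff (h : IsAssociatedNorm v) (x : K) : ‖x‖ < 1 ↔ v x < 1 := by
  obtain ⟨c, hc, h⟩ := h
  rcases eq_or_ne x 0 with rfl | hx
  · simp
  · have hv : v x ≠ 0 := (Valuation.ne_zero_iff v).2 hx
    rw [h x hx, zpow_lt_one_iff_right₀ hc, ← WithZero.log_one, WithZero.log_lt_log hv one_ne_zero]

lemma IsAssociatedNorm.norm_natCast_le_one (h : IsAssociatedNorm v) (n : ℕ) : ‖(n : K)‖ ≤ 1 := by
  rw [h.norm_le_one_iff]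
  exact (n : v.valuationSubring).2

lemma IsAssociatedNorm.isUltrametricDist (h : IsAssociatedNorm v) : IsUltrametricDist K :=
  IsUltrametricDist.isUltrametricDist_of_forall_norm_natCast_le_one h.norm_natCast_le_one

/-- The reduction is `t²(t + 1)`, whose root `-1` is simple in every residue characteristic. -/
lemma IsAssociatedNorm.exists_cubic_root (h : IsAssociatedNorm v)
    [HenselianLocalRing v.valuationSubring] {b c : K} (hb : ‖b‖ < 1) (hc : ‖c‖ < 1) :
    ∃ t : K, ‖t‖ = 1 ∧ t ^ 3 + t ^ 2 + b * t + c = 0 := by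
  have := h.isUltrametricDist
  have hb' := (h.norm_lt_one_iff b).1 hb
  have hc' := (h.norm_lt_one_iff c).1 hc
  let B : v.valuationSubring := ⟨b, hb'.le⟩
  let D : v.valuationSubring := ⟨c, hc'.le⟩
  let f : v.valuationSubring[X] :=
    X ^ 3 + (Polynomial.C 1 * X ^ 2 + Polynomial.C B * X + Polynomial.C D)
  have hf : f.Monic := monic_X_pow_add (by compute_degree!)
  obtain ⟨t, ht, ht1⟩ := HenselianLocalRing.is_henselian f hf (-1) (by
      rw [Valuation.mem_maximalIdeal_iff, ← h.norm_lt_one_iff]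
      have : ((f.eval (-1) : v.valuationSubring) : K) = c - b := by
        simp [f, B, D]; ring
      rw [this]
      rw [sub_eq_add_neg]
      exact (IsUltrametricDist.norm_add_le_max c (-b)).trans_lt (max_lt hc (by rwa [norm_neg]))) (by
      rw [(Valuation.valuationSubring.integers v).isUnit_iff_valuation_eq_one]
      have : algebraMap v.valuationSubring K (f.derivative.eval (-1)) = 1 + b := by
        change ((f.derivative.eval (-1) : v.valuationSubring) : K) = 1 + b
        have h2 : ((2 : v.valuationSubring) : K) = 2 := rfl
        simp [f, B, D, h2]; ring
      rw [this]
      exact v.map_one_add_of_lt hb')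
  refine ⟨t, ?_, ?_⟩
  · rw [Valuation.mem_maximalIdeal_iff, ← h.norm_lt_one_iff] at ht1
    have h1 : (t : K) = -1 + ((t - (-1) : v.valuationSubring) : K) := by simp
    rw [h1, norm_add_eq_of_lt (by simpa using ht1)]
    simp
  · have := congrArg (Subtype.val) ht
    simp [f, B, D] at this
    linear_combination this

variable {C : Type*} [NormedField C] [IsUltrametricDist C] [Algebra K C]

/-- A fixed point that is closer to a rational point than to the other fixed points is rational. -/
lemma IsAssociatedNorm.exists_algebraMap_eq (h : IsAssociatedNorm v)
    [HenselianLocalRing v.valuationSubring] (hC : ∀ x : K, ‖algebraMap K C x‖ = ‖x‖)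
    {e₁ e₂ e₃ y : K} {α β γ : C} {R : ℝ}
    (h₁ : algebraMap K C e₁ = α + β + γ) (h₂ : algebraMap K C e₂ = α * β + α * γ + β * γ)
    (h₃ : algebraMap K C e₃ = α * β * γ) (hα : ‖γ - α‖ = R) (hβ : ‖γ - β‖ = R)
    (hy : ‖algebraMap K C y - γ‖ < R) : ∃ x : K, algebraMap K C x = γ := by
  have hR : 0 < R := (norm_nonneg _).trans_lt hy
  set Y := algebraMap K C y with hY
  have hu : ‖Y - α‖ = R := by
    have : Y - α = (γ - α) + (Y - γ) := by ring
    rw [this, norm_add_eq_of_lt (by rwa [hα]), hα]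
  have hv : ‖Y - β‖ = R := by
    have : Y - β = (γ - β) + (Y - γ) := by ring
    rw [this, norm_add_eq_of_lt (by rwa [hβ]), hβ]
  -- `Z³ + bZ² + cZ + d` is `(y + Z - α)(y + Z - β)(y + Z - γ)`, expanded over `K`.
  set b := 3 * y - e₁ with hb
  set c := 3 * y ^ 2 - 2 * e₁ * y + e₂ with hc
  set d := y ^ 3 - e₁ * y ^ 2 + e₂ * y - e₃ with hd
  have hbC : algebraMap K C b = (Y - α) + (Y - β) + (Y - γ) := by
    simp only [hb, map_sub, map_mul, map_ofNat, h₁, ← hY]; ring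
  have hcC : algebraMap K C c = (Y - α) * (Y - β) + ((Y - α) + (Y - β)) * (Y - γ) := by
    simp only [hc, map_sub, map_add, map_mul, map_pow, map_ofNat, h₁, h₂, ← hY]; ring
  have hdC : algebraMap K C d = (Y - α) * (Y - β) * (Y - γ) := by
    simp only [hd, map_sub, map_add, map_mul, map_pow, h₁, h₂, h₃, ← hY]; ring
  have hb' : ‖b‖ ≤ R := by
    rw [← hC, hbC]
    exact norm_add_le_of_le (norm_add_le_of_le hu.le hv.le) hy.le
  have hc' : ‖c‖ = R ^ 2 := by
    have h1 : ‖(Y - α) * (Y - β)‖ = R ^ 2 := by rw [norm_mul, hu, hv, sq]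
    rw [← hC, hcC, norm_add_eq_of_lt, h1]
    rw [h1, norm_mul, sq]
    exact mul_lt_mul_of_le_of_lt_of_nonneg_of_pos (norm_add_le_of_le hu.le hv.le) hy
      (norm_nonneg _) hR
  set r := ‖Y - γ‖ with hr
  have hr0 : 0 ≤ r := norm_nonneg _
  have hd' : ‖d‖ = R ^ 2 * r := by
    rw [← hC, hdC, norm_mul, norm_mul, hu, hv, sq]
  have hc0 : c ≠ 0 := by
    rw [← norm_pos_iff, hc']; positivity
  -- The small root is close to `-d / c`. Substituting `Z = d / (c t)` normalizes the equation to
  -- `t³ + t² + (bd/c²) t + d²/c³ = 0`, with the last two coefficients of norm less than `1`.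
  obtain ⟨t, ht1, ht⟩ := h.exists_cubic_root (b := b * d / c ^ 2) (c := d ^ 2 / c ^ 3) (by
      rw [norm_div, norm_mul, norm_pow, hd', hc', div_lt_one (by positivity)]
      calc _ ≤ R * (R ^ 2 * r) := by gcongr
        _ < R * (R ^ 2 * R) := by gcongr
        _ = _ := by ring) (by
      rw [norm_div, norm_pow, norm_pow, hd', hc', div_lt_one (by positivity)]
      calc _ < (R ^ 2 * R) ^ 2 := by gcongr
        _ = _ := by ring)
  have ht0 : t ≠ 0 := by
    rw [← norm_pos_iff, ht1]; exact one_pos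
  set z := d / (c * t) with hz
  have hzn : ‖z‖ < R := by
    rw [hz, norm_div, norm_mul, hd', hc', ht1, mul_one, mul_div_cancel_left₀ _ (by positivity)]
    exact hy
  have hroot : z ^ 3 + b * z ^ 2 + c * z + d = 0 := by
    have : z ^ 3 + b * z ^ 2 + c * z + d =
        d / t ^ 3 * (t ^ 3 + t ^ 2 + b * d / c ^ 2 * t + d ^ 2 / c ^ 3) := by
      rw [hz]; field_simp; ring
    rw [this, ht, mul_zero]
  set Z := algebraMap K C z with hZ
  have hZn : ‖Z‖ < R := by rwa [hZ, hC]
  have hprod : (Y + Z - α) * (Y + Z - β) * (Y + Z - γ) = 0 := by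
    have := congrArg (algebraMap K C) hroot
    simp only [map_add, map_mul, map_pow, map_zero, hbC, hcC, hdC, ← hZ] at this
    linear_combination this
  refine ⟨y + z, ?_⟩
  rw [map_add, ← hY, ← hZ]
  -- Since `‖Z‖ < R`, the root `Y + Z` stays at distance `R` from `α` and `β`, so it must be `γ`.
  have hne {x : C} (hx : ‖Y - x‖ = R) : Y + Z - x ≠ 0 := by
    have : Y + Z - x = (Y - x) + Z := by ring
    rw [← norm_pos_iff, this, norm_add_eq_of_lt (by rwa [hx]), hx]
    exact hR
  rcases mul_eq_zero.1 hprod with h' | h'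
  · exact absurd h' (mul_ne_zero (hne hu) (hne hv))
  · exact sub_eq_zero.1 h'

/-- If two of three points lie close together, then the third one can be approximated by a rational
function of the elementary symmetric functions. -/
lemma exists_norm_algebraMap_sub_lt {e₁ e₂ e₃ : K} {α β γ : C} {R : ℝ}
    (h₁ : algebraMap K C e₁ = α + β + γ) (h₂ : algebraMap K C e₂ = α * β + α * γ + β * γ)
    (h₃ : algebraMap K C e₃ = α * β * γ) (hα : ‖γ - α‖ = R) (hβ : ‖γ - β‖ = R)
    (hαβ : ‖α - β‖ < R) : ∃ y : K, ‖algebraMap K C y - γ‖ < R := by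
  have hR : 0 < R := (norm_nonneg _).trans_lt hαβ
  set q := (α - γ) ^ 2 + (β - γ) * (β - α) with hq
  have hqn : ‖q‖ = R ^ 2 := by
    have h1 : ‖(α - γ) ^ 2‖ = R ^ 2 := by rw [norm_pow, norm_sub_rev, hα]
    rw [hq, norm_add_eq_of_lt, h1]
    rw [h1, norm_mul, norm_sub_rev, hβ, norm_sub_rev β, sq]
    gcongr
  have hq0 : q ≠ 0 := by
    rw [← norm_pos_iff, hqn]; positivity
  -- If `α = β`, the quotient equals `2α` and this expression is exactly `γ`. In general the error
  -- is quadratic in `α - β`. No division by `2` or `3` occurs.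
  refine ⟨e₁ - (e₁ * e₂ - 9 * e₃) / (e₁ ^ 2 - 3 * e₂), ?_⟩
  have hden : algebraMap K C (e₁ ^ 2 - 3 * e₂) = q := by
    simp only [map_sub, map_mul, map_pow, map_ofNat, h₁, h₂, hq]; ring
  have hval : algebraMap K C (e₁ - (e₁ * e₂ - 9 * e₃) / (e₁ ^ 2 - 3 * e₂)) - γ =
      ((α - γ) + (β - γ)) * (α - β) ^ 2 / q := by
    rw [map_sub, map_div₀, hden, eq_div_iff hq0, sub_mul, sub_mul, div_mul_cancel₀ _ hq0]
    simp only [map_sub, map_mul, map_ofNat, h₁, h₂, h₃, hq]; ring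
  rw [hval, norm_div, hqn, div_lt_iff₀ (by positivity), norm_mul, norm_pow]
  have h1 : ‖(α - γ) + (β - γ)‖ ≤ R :=
    norm_add_le_of_le (by rw [norm_sub_rev, hα]) (by rw [norm_sub_rev, hβ])
  calc _ ≤ R * ‖α - β‖ ^ 2 := by gcongr
    _ < R * R ^ 2 := by gcongr

end Henselian

/-! ### Configurations of the fixed points -/

section Main

open Polynomial

variable {K : Type*} [NormedField K] {v : Valuation K (WithZero (Multiplicative ℤ))}
  {C : Type*} [NormedField C] [Algebra K C]

/-- The fixed points need not be rational, but their symmetric functions are read off the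
coefficients of `φ`. -/
lemma exists_symmetric_functions {φ : K[X]} {a α β γ : C} (ha : a ≠ 0)
    (hφ : φ.map (algebraMap K C) = fixedPointCubic a α β γ) :
    ∃ e₁ e₂ e₃ : K, algebraMap K C e₁ = α + β + γ ∧
      algebraMap K C e₂ = α * β + α * γ + β * γ ∧ algebraMap K C e₃ = α * β * γ := by
  have hexp : fixedPointCubic a α β γ = Polynomial.C a * X ^ 3 +
      Polynomial.C (-(a * (α + β + γ))) * X ^ 2 +
      Polynomial.C (a * (α * β + α * γ + β * γ) + 1) * X +
      Polynomial.C (-(a * (α * β * γ))) := by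
    simp only [fixedPointCubic, map_neg, map_mul, map_add, map_one]; ring
  have hc (n : ℕ) : algebraMap K C (φ.coeff n) = (fixedPointCubic a α β γ).coeff n := by
    rw [← hφ, coeff_map]
  have c3 : algebraMap K C (φ.coeff 3) = a := by
    rw [hc, hexp]
    simp only [coeff_add, coeff_C_mul, coeff_X_pow, coeff_X, coeff_C]; norm_num
  have c2 : algebraMap K C (φ.coeff 2) = -(a * (α + β + γ)) := by
    rw [hc, hexp]
    simp only [coeff_add, coeff_C_mul, coeff_X_pow, coeff_X, coeff_C]; norm_num
  have c1 : algebraMap K C (φ.coeff 1) = a * (α * β + α * γ + β * γ) + 1 := by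
    rw [hc, hexp]
    simp only [coeff_add, coeff_C_mul, coeff_X_pow, coeff_X, coeff_C]; norm_num
  have c0 : algebraMap K C (φ.coeff 0) = -(a * (α * β * γ)) := by
    rw [hc, hexp]
    simp only [coeff_add, coeff_C_mul, coeff_X_pow, coeff_X, coeff_C]; norm_num
  refine ⟨-φ.coeff 2 / φ.coeff 3, (φ.coeff 1 - 1) / φ.coeff 3, -φ.coeff 0 / φ.coeff 3, ?_, ?_, ?_⟩
  · rw [map_div₀, map_neg, c2, c3]; field_simp
  · rw [map_div₀, map_sub, map_one, c1, c3]; field_simp; ring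
  · rw [map_div₀, map_neg, c0, c3]; field_simp

variable [IsUltrametricDist C]

/-- The conclusion for a fixed point that is far from the other ones and close to a rational
point. -/
lemma IsAssociatedNorm.exists_repelling (h : IsAssociatedNorm v)
    [HenselianLocalRing v.valuationSubring] (hC : ∀ x : K, ‖algebraMap K C x‖ = ‖x‖)
    {φ : K[X]} {a α β γ : C} (hφ : φ.map (algebraMap K C) = fixedPointCubic a α β γ) {R : ℝ}
    (hα : ‖γ - α‖ = R) (hβ : ‖γ - β‖ = R) (ha : 1 < ‖a‖ * R ^ 2)
    (hy : ∃ y : K, ‖algebraMap K C y - γ‖ < R) :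
    ∃ z : C, IsRepellingFixedPoint (φ.map (algebraMap K C)) z ∧
      (z : OnePoint C) ∈ rationalJuliaSet C φ := by
  have ha0 : a ≠ 0 := by
    rintro rfl
    norm_num at ha
  obtain ⟨e₁, e₂, e₃, h₁, h₂, h₃⟩ := exists_symmetric_functions ha0 hφ
  obtain ⟨y, hy⟩ := hy
  obtain ⟨x, hx⟩ := h.exists_algebraMap_eq hC h₁ h₂ h₃ hα hβ hy
  have hrep := isRepellingFixedPoint_fixedPointCubic hα hβ ha
  rw [← hφ] at hrep
  exact ⟨γ, hrep, hrep.mem_juliaSet, ⟨x, by simp [hx]⟩⟩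

lemma IsAssociatedNorm.exists_repelling_of_isosceles (h : IsAssociatedNorm v)
    [HenselianLocalRing v.valuationSubring] (hC : ∀ x : K, ‖algebraMap K C x‖ = ‖x‖)
    {φ : K[X]} {a α β γ : C} (hφ : φ.map (algebraMap K C) = fixedPointCubic a α β γ)
    (ha : 1 < ‖a‖ * ‖γ - α‖ ^ 2) (hαβ : ‖α - β‖ < ‖γ - α‖) :
    ∃ z : C, IsRepellingFixedPoint (φ.map (algebraMap K C)) z ∧
      (z : OnePoint C) ∈ rationalJuliaSet C φ := by
  have hβ : ‖γ - β‖ = ‖γ - α‖ := by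
    have : γ - β = (γ - α) + (α - β) := by ring
    rw [this, norm_add_eq_of_lt hαβ]
  have ha0 : a ≠ 0 := by
    rintro rfl
    norm_num at ha
  obtain ⟨e₁, e₂, e₃, h₁, h₂, h₃⟩ := exists_symmetric_functions ha0 hφ
  exact h.exists_repelling hC hφ rfl hβ ha (exists_norm_algebraMap_sub_lt h₁ h₂ h₃ rfl hβ hαβ)

/-- Every fixed point is repelling here, but possibly none is rational without further input: the
rational Julia point approximates one of them. -/
lemma IsAssociatedNorm.exists_repelling_of_equilateral (h : IsAssociatedNorm v)
    [HenselianLocalRing v.valuationSubring] (hC : ∀ x : K, ‖algebraMap K C x‖ = ‖x‖)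
    {φ : K[X]} {a α β γ : C} (hφ : φ.map (algebraMap K C) = fixedPointCubic a α β γ) {R : ℝ}
    (hαβ : ‖α - β‖ = R) (hαγ : ‖α - γ‖ = R) (hβγ : ‖β - γ‖ = R) (hR : 0 < R)
    (ha : 1 < ‖a‖ * R ^ 2) (hJ : (rationalJuliaSet C φ).Nonempty) :
    ∃ z : C, IsRepellingFixedPoint (φ.map (algebraMap K C)) z ∧
      (z : OnePoint C) ∈ rationalJuliaSet C φ := by
  have hβα := norm_sub_rev α β ▸ hαβ
  have hγα := norm_sub_rev α γ ▸ hαγ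
  have hγβ := norm_sub_rev β γ ▸ hβγ
  obtain ⟨P, hP, Q, rfl⟩ := hJ
  rw [hφ] at hP
  induction Q using OnePoint.rec with
  | infty =>
    obtain ⟨z, hz, -⟩ := exists_of_mem_juliaSet hR hβα.le hγα.le ha.le hP
    exact absurd hz (OnePoint.infty_ne_coe z)
  | coe x =>
    rw [OnePoint.map_some] at hP
    rcases norm_sub_lt_of_mem_juliaSet hR hβα hγα ha hP with hx | hx | hx
    · exact h.exists_repelling hC (hφ.trans (fixedPointCubic_rotate _ _ _ _)) hαβ hαγ ha ⟨x, hx⟩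
    · exact h.exists_repelling hC (((hφ.trans (fixedPointCubic_rotate _ _ _ _)).trans
        (fixedPointCubic_rotate _ _ _ _))) hβγ hβα ha ⟨x, hx⟩
    · exact h.exists_repelling hC hφ hγα hγβ ha ⟨x, hx⟩

lemma IsAssociatedNorm.exists_repelling_of_nonempty (h : IsAssociatedNorm v)
    [HenselianLocalRing v.valuationSubring] (hC : ∀ x : K, ‖algebraMap K C x‖ = ‖x‖)
    {φ : K[X]} {a α β γ : C} (ha : a ≠ 0)
    (hφ : φ.map (algebraMap K C) = fixedPointCubic a α β γ)
    (hJ : (rationalJuliaSet C φ).Nonempty) :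
    ∃ z : C, IsRepellingFixedPoint (φ.map (algebraMap K C)) z ∧
      (z : OnePoint C) ∈ rationalJuliaSet C φ := by
  have ha' : 0 < ‖a‖ := norm_pos_iff.2 ha
  -- The radius of good reduction, where `‖a‖ * r ^ 2 = 1`.
  set r := Real.sqrt ‖a‖⁻¹ with hr
  have hr0 : 0 < r := Real.sqrt_pos.2 (inv_pos.2 ha')
  have har : ‖a‖ * r ^ 2 = 1 := by
    rw [hr, Real.sq_sqrt (inv_pos.2 ha').le, mul_inv_cancel₀ ha'.ne']
  have hbig {s : ℝ} (hs : r < s) : 1 < ‖a‖ * s ^ 2 := by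
    rw [← har]; gcongr
  have hfar : r < ‖β - α‖ ∨ r < ‖γ - α‖ := by
    by_contra! hclose
    obtain ⟨P, hP, -⟩ := hJ
    rw [hφ, juliaSet_eq_empty hr0 hclose.1 hclose.2 har] at hP
    exact hP
  have hsum : γ - α = (γ - β) + (β - α) := by ring
  -- Ultrametric triangles are isosceles with the two longest sides equal. The apex is `γ` in the
  -- first case and `β` in the last; when the two sides at `α` agree, either `α` is the apex or the
  -- triangle is equilateral.
  rcases lt_trichotomy ‖β - α‖ ‖γ - α‖ with hlt | heq | hlt
  · refine h.exists_repelling_of_isosceles hC hφ (hbig ?_) (by rwa [norm_sub_rev])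
    rcases hfar with h' | h'
    exacts [h'.trans hlt, h']
  · have hαr : r < ‖γ - α‖ := by rcases hfar with h' | h' <;> linarith
    have hle : ‖β - γ‖ ≤ ‖γ - α‖ := by
      have : β - γ = (β - α) - (γ - α) := by ring
      rw [this]
      exact norm_sub_le_of_le heq.le le_rfl
    rcases hle.lt_or_eq with hlt | heq'
    · refine h.exists_repelling_of_isosceles hC (hφ.trans (fixedPointCubic_rotate _ _ _ _))
        (hbig ?_) ?_
      · rwa [norm_sub_rev, heq]
      · rwa [norm_sub_rev α β, heq]
    · exact h.exists_repelling_of_equilateral hC hφ (by rw [norm_sub_rev, heq])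
        (norm_sub_rev _ _) heq' (hr0.trans hαr) (hbig hαr) hJ
  · have hβr : r < ‖β - α‖ := by
      rcases hfar with h' | h'
      exacts [h', h'.trans hlt]
    exact h.exists_repelling_of_isosceles hC (γ := β) (α := α) (β := γ)
      (by rw [hφ, fixedPointCubic_rotate, fixedPointCubic_rotate, fixedPointCubic_perm_left])
      (hbig hβr) (by rwa [norm_sub_rev])

/-- Over an algebraically closed field, a cubic polynomial is determined by its leading coefficient
and its fixed points. -/
lemma exists_eq_fixedPointCubic {L : Type*} [NormedField L] [IsAlgClosed L] {f : L[X]}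
    (hf : f.natDegree = 3) : ∃ a α β γ : L, a ≠ 0 ∧ f = fixedPointCubic a α β γ := by
  have hdeg : (f - X).natDegree = 3 := by
    rw [natDegree_sub_eq_left_of_natDegree_lt (by rw [natDegree_X, hf]; norm_num), hf]
  have hs := IsAlgClosed.splits (f - X)
  have hcard : Multiset.card (f - X).roots = 3 := by rw [← hs.natDegree_eq_card_roots, hdeg]
  obtain ⟨α, β, γ, hroots⟩ := Multiset.card_eq_three.1 hcard
  refine ⟨(f - X).leadingCoeff, α, β, γ, ?_, ?_⟩
  · rw [Ne, leadingCoeff_eq_zero]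
    intro h0
    simp [h0] at hdeg
  · have := hs.eq_prod_roots
    rw [hroots] at this
    simp only [Multiset.insert_eq_cons, Multiset.map_cons, Multiset.map_singleton,
      Multiset.prod_cons, Multiset.prod_singleton] at this
    rw [fixedPointCubic]
    linear_combination this

end Main

end CubicJulia

theorem theorem2p2 {K : Type*} [NormedField K] (v : Valuation K (WithZero (Multiplicative ℤ)))
    (hv : Function.Surjective v) [HenselianLocalRing v.valuationSubring]
    (hnorm : CubicJulia.IsAssociatedNorm v)
    {L : Type*} [NormedField L] [NormedAlgebra K L] [IsAlgClosure K L]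
    (φ : Polynomial K) (hφ : φ.natDegree = 3)
    (hJ : (CubicJulia.rationalJuliaSet (UniformSpace.Completion L) φ).Nonempty) :
    ∃ z : UniformSpace.Completion L,
      CubicJulia.IsRepellingFixedPoint
        (φ.map (algebraMap K (UniformSpace.Completion L))) z ∧
      (z : OnePoint (UniformSpace.Completion L)) ∈
        CubicJulia.rationalJuliaSet (UniformSpace.Completion L) φ := by
  have := IsAlgClosure.isAlgClosed K (K := L)
  have hcoe (x : K) : algebraMap K (UniformSpace.Completion L) x =
      ((algebraMap K L x : L) : UniformSpace.Completion L) := rfl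
  have hC (x : K) : ‖algebraMap K (UniformSpace.Completion L) x‖ = ‖x‖ := by
    rw [hcoe, UniformSpace.Completion.norm_coe, norm_algebraMap']
  -- Integers already have norm at most `1` in `K`, which makes the norm of any normed extension
  -- field ultrametric.
  have : IsUltrametricDist (UniformSpace.Completion L) :=
    IsUltrametricDist.isUltrametricDist_of_forall_norm_natCast_le_one fun n => by
      rw [← map_natCast (algebraMap K (UniformSpace.Completion L)), hC]
      exact hnorm.norm_natCast_le_one n
  -- The fixed points are found in `L`, which is algebraically closed, and then mapped to the
  -- completion.
  obtain ⟨a, α, β, γ, ha, hf⟩ := CubicJulia.exists_eq_fixedPointCubic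
    (f := φ.map (algebraMap K L)) (by rw [Polynomial.natDegree_map, hφ])
  let ι : L →+* UniformSpace.Completion L := UniformSpace.Completion.coeRingHom
  refine hnorm.exists_repelling_of_nonempty hC (a := ι a) (α := ι α) (β := ι β) (γ := ι γ)
    ((map_ne_zero ι).2 ha) ?_ hJ
  have hcomp : algebraMap K (UniformSpace.Completion L) = ι.comp (algebraMap K L) := rfl
  rw [hcomp, ← Polynomial.map_map, hf]
  simp [CubicJulia.fixedPointCubic]
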